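/- A finite discounted stochastic game consists of $n$ players, a finite set $\mathbb S$ of states, a finite nonempty action set $\mathbb A^i$ for each player $i\in[n]$ (put $\mathbb A=\prod_i\mathbb A^i$), transition probabilities $P(\cdot\mid s,a)\in\Delta(\mathbb S)$ and rewards $r^i(s,a)\ge 0$ for $s\in\mathbb S$, $a\in\mathbb A$, $i\in[n]$, and a discount factor $\gamma\in[0,1)$. A strategy of player $i$ is a map $\pi^i:\mathbb S\to\Delta(\mathbb A^i)$, and a strategy profile is a family $\pi=(\pi^1,\dots,\pi^n)$ of strategies. Under $\pi$ and the starting state $s_0=s$, at each time $t$ the joint action $a_t$ is drawn from the product distribution $\pi(s_t,a)=\prod_i\pi^i(s_t,a^i)$ and then $s_{t+1}$ is drawn from $P(\cdot\mid s_t,a_t)$; the value for player $i$ is $$V^{\pi^i,\pi^{-i}}(s)=\mathbb E\Big[\sum_{t=0}^\infty\gamma^t r^i(s_t,a_t)\,\Big|\,s_0=s\Big].$$ A profile $\pi$ is a Markov perfect equilibrium (MPE) if $V^{\pi^i,\pi^{-i}}(s)\ge V^{\tilde\pi^i,\pi^{-i}}(s)$ for all $s\in\mathbb S$, all $i\in[n]$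 and all strategies $\tilde\pi^i$ of player $i$. For $a^i\in\mathbb A^i$ let $V^{\pi^i,\pi^{-i}}_{\pi^i(s,a^i)=1}(s)$ be the value of player $i$ at $s$ when player $i$ plays the pure action $a^i$ at state $s$ and $\pi^i(s')$ at every state $s'\ne s$, while every other player $j$ uses $\pi^j$. Define the self-map $f$ of the set of strategy profiles by $$(f(\pi))^i(s,a^i)=\frac{\pi^i(s,a^i)+\max\big(0,\,V^{\pi^i,\pi^{-i}}_{\pi^i(s,a^i)=1}(s)-V^{\pi^i,\pi^{-i}}(s)\big)}{1+\sum_{b^i\in\mathbb A^i}\max\big(0,\,V^{\pi^i,\pi^{-i}}_{\pi^i(s,b^i)=1}(s)-V^{\pi^i,\pi^{-i}}(s)\big)}.$$ **Theorem.** For every finite discounted stochastic game, a strategy profile $\pi$ is an MPE if and only if $f(\pi)=\pi$. Furthermore, $f$ has at least one fixed point; hence an MPE exists. -/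

import Mathlib

open MeasureTheory ProbabilityTheory

universe u v

noncomputable section

/-- A stochastic game with players `Fin n`, finite state set `S` and finite action sets `A i`:
transition probabilities `P s a ∈ Δ(S)`, nonnegative rewards, discount factor in `[0, 1)`. -/
structure StochasticGame (n : ℕ) (S : Type u) [Fintype S] (A : Fin n → Type v) where
  /-- `P s a s'` is the probability of moving from `s` to `s'` under the joint action `a`. -/
  P : S → (∀ i, A i) → stdSimplex ℝ S
  /-- `r i s a` is the reward of player `i` at state `s` under the joint action `a`. -/
  r : Fin n → S → (∀ i, A i) → ℝ
  r_nonneg : ∀ i s a, 0 ≤ r i s a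
  γ : ℝ
  γ_nonneg : 0 ≤ γ
  γ_lt_one : γ < 1

namespace StochasticGame

/-- Behavioral (stationary Markov) strategies `S → Δ(B)` of a player with action set `B`. -/
abbrev Strategy (S : Type u) (B : Type v) [Fintype B] : Type (max u v) :=
  S → stdSimplex ℝ B

/-- Strategy profiles: one behavioral strategy for each player. -/
abbrev Profile (n : ℕ) (S : Type u) (A : Fin n → Type v) [∀ i, Fintype (A i)] : Type (max u v) :=
  ∀ i, Strategy S (A i)

/-- A point of the standard simplex as a probability mass function. -/
def toPMF {B : Type*} [Fintype B] (p : stdSimplex ℝ B) : PMF B :=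
  PMF.ofFintype (fun b => ENNReal.ofReal (p b)) (by
    have h : ∑ b, p b = 1 := p.2.2
    rw [← ENNReal.ofReal_sum_of_nonneg (f := fun b => p b) (fun b _ => p.2.1 b), h,
      ENNReal.ofReal_one])

/-- What happens at one time step: the current state and the joint action played there. -/
structure Outcome {n : ℕ} (S : Type u) (A : Fin n → Type v) : Type (max u v) where
  state : S
  action : ∀ i, A i

instance {n : ℕ} (S : Type u) (A : Fin n → Type v) : MeasurableSpace (Outcome S A) := ⊤

instance {n : ℕ} (S : Type u) (A : Fin n → Type v) : DiscreteMeasurableSpace (Outcome S A) :=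
  ⟨fun _ => trivial⟩

instance {n : ℕ} (S : Type u) [Fintype S] (A : Fin n → Type v) [∀ i, Fintype (A i)] :
    Finite (Outcome S A) :=
  Finite.of_injective (fun x : Outcome S A => (x.state, x.action)) (by
    rintro ⟨s, a⟩ ⟨s', a'⟩ h
    simp only [Prod.mk.injEq] at h
    rw [h.1, h.2])

section

variable {n : ℕ} {S : Type u} [Fintype S] {A : Fin n → Type v} [∀ i, Fintype (A i)]

/-- The product distribution `π(s, ·)` on joint actions: at state `s` the players randomize
independently, so `π(s, a) = ∏ i, πⁱ(s, aⁱ)`. -/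
def jointAction (π : Profile n S A) (s : S) : stdSimplex ℝ (∀ i, A i) :=
  ⟨fun a => ∏ i, π i s (a i), fun a => Finset.prod_nonneg fun i _ => (π i s).2.1 (a i), by
    classical
    have h := Finset.prod_univ_sum (fun i => (Finset.univ : Finset (A i))) (fun i b => π i s b)
    rw [Fintype.piFinset_univ] at h
    rw [← h]
    exact Finset.prod_eq_one fun i _ => (π i s).2.2⟩

/-- The law of the outcome at one time step, given that the state is `s`. -/
def outcomeAt (π : Profile n S A) (s : S) : PMF (Outcome S A) :=
  (toPMF (jointAction π s)).map fun a => ⟨s, a⟩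

/-- The law of the next outcome: after `(s, a)` the next state `s'` is drawn from `P(· | s, a)`,
then the joint action from `π(s', ·)`. -/
def nextOutcome (G : StochasticGame n S A) (π : Profile n S A) (x : Outcome S A) :
    PMF (Outcome S A) :=
  (toPMF (G.P x.state x.action)).bind (outcomeAt π)

/-- The transition kernels of the play; the next outcome depends only on the last one. -/
def stepKernel (G : StochasticGame n S A) (π : Profile n S A) (t : ℕ) :
    Kernel (∀ _ : Finset.Iic t, Outcome S A) (Outcome S A) :=
  Kernel.ofFunOfCountable fun h =>
    (G.nextOutcome π (h ⟨t, Finset.mem_Iic.2 le_rfl⟩)).toMeasure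

instance (G : StochasticGame n S A) (π : Profile n S A) (t : ℕ) :
    IsMarkovKernel (G.stepKernel π t) :=
  ⟨fun h => inferInstanceAs (IsProbabilityMeasure
    (G.nextOutcome π (h ⟨t, Finset.mem_Iic.2 le_rfl⟩)).toMeasure)⟩

/-- The law of the infinite play `(s₀, a₀), (s₁, a₁), …` under `π` started at `s₀ = s`. -/
def playLaw (G : StochasticGame n S A) (π : Profile n S A) (s : S) :
    Measure (ℕ → Outcome S A) :=
  Kernel.trajMeasure (X := fun _ => Outcome S A) (outcomeAt π s).toMeasure (G.stepKernel π)

/-- The value function: the expected discounted sum of the rewards of player `i` under `π`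
when the play starts at `s`. -/
def value (G : StochasticGame n S A) (π : Profile n S A) (i : Fin n) (s : S) : ℝ :=
  ∫ ω, ∑' t : ℕ, G.γ ^ t * G.r i (ω t).state (ω t).action ∂(G.playLaw π s)

open Classical in
/-- Markov perfect equilibrium: no player gains, from any starting state, by replacing the own
behavioral strategy with another one. -/
def IsMPE (G : StochasticGame n S A) (π : Profile n S A) : Prop :=
  ∀ (s : S) (i : Fin n) (σ : Strategy S (A i)),
    G.value (Function.update π i σ) i s ≤ G.value π i s

open Classical in
/-- The profile in which player `i` plays the pure action `a` at state `s` and which otherwise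
agrees with `π`. -/
def pureDeviation (π : Profile n S A) (i : Fin n) (s : S) (a : A i) : Profile n S A :=
  Function.update π i
    (Function.update (π i) s ⟨Pi.single a 1, single_mem_stdSimplex ℝ a⟩)

/-- The positive part of the gain of player `i`, starting from `s`, from playing the pure action
`a` at the one state `s`. -/
def gain (G : StochasticGame n S A) (π : Profile n S A) (i : Fin n) (s : S) (a : A i) : ℝ :=
  max 0 (G.value (pureDeviation π i s a) i s - G.value π i s)

/-- The Nash-type map `f` on strategy profiles. -/
def nashMap (G : StochasticGame n S A) (π : Profile n S A) : Profile n S A := fun i s =>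
  ⟨fun a => (π i s a + G.gain π i s a) / (1 + ∑ b, G.gain π i s b), by
    have hg : ∀ b, 0 ≤ G.gain π i s b := fun b => le_max_left _ _
    have hs : 0 ≤ ∑ b, G.gain π i s b := Finset.sum_nonneg fun b _ => hg b
    have h1 : ∑ b, π i s b = 1 := (π i s).2.2
    refine ⟨fun a => div_nonneg (add_nonneg ((π i s).2.1 a) (hg a)) (by linarith), ?_⟩
    rw [← Finset.sum_div, Finset.sum_add_distrib, h1]
    exact div_self (by linarith)⟩

end

end StochasticGame

end

/-! Fix a player `i`, let `V` be the value under `π`, and let `Q(s,b)` be the one-shot value of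
action `b` at `s` with continuation `V` (`actionValue`). `V` solves the Bellman equation
(`bellman_value`). The Bellman operator is monotone and scales added constants by `γ < 1`, so every
subsolution lies below every supersolution (`le_of_bellman_le`).

Changing the action at the single state `s` leaves the Bellman equation of `V` intact elsewhere.
Comparison therefore shows that the deviation gains at `s` exactly when `Q(s,b) > V(s)`. If no such
gain exists, `V` is a supersolution for every strategy of player `i`, so `π` is an MPE exactly when
all gains vanish (`isMPE_iff_gain_eq_zero`). At a fixed point of `f` each gain is `π(s,b)` times the
total gain. A positive total would give `Q > V` on the whole support of `π(s,·)`, although `V(s)` is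
the `π`-average of `Q(s,·)`.

For existence, `V` is a uniformly convergent series of functions polynomial in `π`, so `f` is
continuous. The profiles form a retract of a Euclidean space, and Brouwer applies. Brouwer itself
rests on the impossibility of a `C¹` retraction of a ball onto its sphere: the integral of the
Jacobian of `x + t H(x)` is polynomial in `t` and equals the volume of the ball for small `t`, hence
also at `t = 1`, where a retraction would have zero Jacobian. -/

set_option linter.unusedSectionVars false

/-! ### Brouwer's theorem by a volume-polynomial argument -/

section Brouwer

open Metric Set
open scoped NNReal

/-- The determinant along an affine line of operators is a polynomial. -/
theorem exists_polynomial_eval_eq_det_one_add_smul {E : Type*} [NormedAddCommGroup E]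
    [NormedSpace ℝ E] [FiniteDimensional ℝ E] (A : E →L[ℝ] E) :
    ∃ q : Polynomial ℝ, q.natDegree ≤ Module.finrank ℝ E ∧
      ∀ t : ℝ, q.eval t = (1 + t • A).det := by
  let b := Module.finBasis ℝ E
  let M := LinearMap.toMatrix b b (A : E →ₗ[ℝ] E)
  refine ⟨((Polynomial.X : Polynomial ℝ) • M.map Polynomial.C +
    (1 : Matrix _ _ ℝ).map Polynomial.C).det, ?_, fun t => ?_⟩
  · simpa using Polynomial.natDegree_det_X_add_C_le M 1
  · rw [← Polynomial.coe_evalRingHom, RingHom.map_det]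
    rw [ContinuousLinearMap.det, ← LinearMap.det_toMatrix b]
    congr 1
    have h : ((1 + t • A : E →L[ℝ] E) : E →ₗ[ℝ] E) = LinearMap.id + t • (A : E →ₗ[ℝ] E) := rfl
    have h2 : LinearMap.toMatrix b b ((1 + t • A : E →L[ℝ] E) : E →ₗ[ℝ] E) = 1 + t • M := by
      rw [h, map_add, map_smul, LinearMap.toMatrix_id]
    rw [h2]
    ext i j
    by_cases hij : i = j
    · subst hij; simp [M, add_comm, mul_comm t]
    · simp [M, Matrix.one_apply_ne hij, mul_comm t]

/-- The determinant at `1 + A` is a fixed affine combination of its values at `1 + t • A` for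
finitely many prescribed small `t`. -/
theorem exists_affine_combination_det {E : Type*} [NormedAddCommGroup E]
    [NormedSpace ℝ E] [FiniteDimensional ℝ E] {δ : ℝ} (hδ : 0 < δ) :
    ∃ (s : Finset ℕ) (t w : ℕ → ℝ), (∀ j, 0 < t j ∧ t j ≤ δ) ∧ ∑ j ∈ s, w j = 1 ∧
      ∀ A : E →L[ℝ] E, (1 + A).det = ∑ j ∈ s, w j * (1 + t j • A).det := by
  -- The determinant has degree at most `finrank` in `t`, so `finrank + 1` distinct nodes determine
  -- it. The weights are the Lagrange basis polynomials evaluated at `1`.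
  let s := Finset.range (Module.finrank ℝ E + 1)
  let t : ℕ → ℝ := fun j => δ / (j + 1)
  have hinj : Set.InjOn t s := by
    intro i _ j _ h
    have h' : δ / (i + 1 : ℝ) = δ / (j + 1) := h
    rw [div_eq_div_iff (by positivity) (by positivity)] at h'
    exact_mod_cast (add_right_cancel (mul_left_cancel₀ hδ.ne' h')).symm
  refine ⟨s, t, fun j => (Lagrange.basis s t j).eval 1, fun j => ⟨by positivity, ?_⟩, ?_, ?_⟩
  · exact div_le_self hδ.le (by linarith [(Nat.cast_nonneg j : (0 : ℝ) ≤ j)])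
  · rw [← Polynomial.eval_finsetSum, Lagrange.sum_basis hinj ⟨0, by simp [s]⟩, Polynomial.eval_one]
  · intro A
    obtain ⟨q, hq, hqt⟩ := exists_polynomial_eval_eq_det_one_add_smul A
    have hdeg : q.degree < s.card := by
      refine lt_of_le_of_lt Polynomial.degree_le_natDegree ?_
      simp only [s, Finset.card_range]
      exact_mod_cast Nat.lt_succ_of_le hq
    have h1 := hqt 1
    rw [one_smul] at h1
    rw [← h1]
    conv_lhs => rw [Lagrange.eq_interpolate hinj hdeg]
    rw [Lagrange.interpolate_apply, Polynomial.eval_finsetSum]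
    refine Finset.sum_congr rfl fun j _ => ?_
    rw [Polynomial.eval_mul, Polynomial.eval_C, hqt, mul_comm]

/-- Solving `x + t H(x) = y` means finding the fixed point of the contraction `x ↦ y - t H(x)`. -/
theorem bijective_add_smul_of_lipschitz {E : Type*} [NormedAddCommGroup E]
    [NormedSpace ℝ E] [CompleteSpace E] {H : E → E} {L : ℝ≥0} (hL : LipschitzWith L H) {t : ℝ≥0}
    (ht : t * L < 1) : Function.Bijective fun x => x + (t : ℝ) • H x := by
  have hc : ∀ y, ContractingWith (t * L) fun x => y - (t : ℝ) • H x := fun y =>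
    ⟨ht, LipschitzWith.of_dist_le_mul fun a b => by
      rw [dist_sub_left, dist_smul₀, NNReal.coe_mul, mul_assoc, Real.norm_of_nonneg t.coe_nonneg]
      exact mul_le_mul_of_nonneg_left (hL.dist_le_mul a b) t.2⟩
  constructor
  · intro a b hab
    have hab' : a + (t : ℝ) • H a = b + (t : ℝ) • H b := hab
    refine (hc (a + (t : ℝ) • H a)).fixedPoint_unique' ?_ ?_
    · simp [Function.IsFixedPt]
    · rw [hab']; simp [Function.IsFixedPt]
  · intro y
    refine ⟨(hc y).fixedPoint, ?_⟩
    have h : y - (t : ℝ) • H (hc y).fixedPoint = (hc y).fixedPoint :=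
      (hc y).fixedPoint_isFixedPt.eq
    exact (sub_eq_iff_eq_add.1 h).symm

/-- The bijection is the identity off `U`, so it preserves the complement of `U` and hence `U`. -/
theorem image_ball_add_smul_of_lipschitz {E : Type*} [NormedAddCommGroup E]
    [NormedSpace ℝ E] [CompleteSpace E] {H : E → E} {L : ℝ≥0} (hL : LipschitzWith L H) {U : Set E}
    (h0 : ∀ x ∉ U, H x = 0) {t : ℝ≥0} (ht : t * L < 1) :
    (fun x => x + (t : ℝ) • H x) '' U = U := by
  have hb := bijective_add_smul_of_lipschitz hL ht
  have hc : (fun x => x + (t : ℝ) • H x) '' Uᶜ = Uᶜ := by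
    rw [Set.image_congr (g := id) fun x hx => by simp [h0 x hx], Set.image_id]
  rw [← compl_inj_iff, ← Set.image_compl_eq hb, hc]

/-- For small `t` the change of variables `x + t H(x)` maps `U` onto itself with positive Jacobian,
so the integral is the volume. An affine combination with weights of sum `1` carries this to `t =
1`. -/
theorem integral_det_one_add_fderiv {E : Type*} [NormedAddCommGroup E]
    [NormedSpace ℝ E] [FiniteDimensional ℝ E] [MeasurableSpace E] [BorelSpace E]
    (μ : Measure E) [μ.IsAddHaarMeasure] {H : E → E} {L : ℝ≥0}
    (hL : LipschitzWith L H) {U : Set E} (hU : IsOpen U) (hUfin : μ U ≠ ⊤)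
    (h0 : ∀ x ∉ U, H x = 0) (hd : ∀ x ∈ U, DifferentiableAt ℝ H x) :
    ∫ x in U, (1 + fderiv ℝ H x).det ∂μ = μ.real U := by
  obtain ⟨ε, hε, hdet⟩ : ∃ ε > 0, ∀ M : E →L[ℝ] E, ‖M - 1‖ < ε → 0 < M.det := by
    have hcont : ContinuousAt (fun M : E →L[ℝ] E => M.det) 1 :=
      ContinuousLinearMap.continuous_det.continuousAt
    have h1 : (0 : ℝ) < (1 : E →L[ℝ] E).det := by
      have : (1 : E →L[ℝ] E).det = 1 := LinearMap.det_id
      rw [this]; exact one_pos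
    obtain ⟨ε, hε, h⟩ := Metric.eventually_nhds_iff.1 (hcont.eventually (lt_mem_nhds h1))
    exact ⟨ε, hε, fun M hM => h (by rwa [dist_eq_norm])⟩
  -- For `t ≤ δ`, `t L < 1` makes the map bijective and `t L < ε` keeps its determinant positive.
  let δ : ℝ := min 1 ε / (2 * (L + 1))
  have hLpos : (0 : ℝ) < L + 1 := by positivity
  have hδ : 0 < δ := by positivity
  have key : ∀ t : ℝ, 0 < t → t ≤ δ →
      IntegrableOn (fun x => (1 + t • fderiv ℝ H x).det) U μ ∧
      ∫ x in U, (1 + t • fderiv ℝ H x).det ∂μ = μ.real U := by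
    intro t ht htδ
    have htL : t * L < min 1 ε := by
      calc t * L ≤ δ * (L + 1) := by gcongr; linarith
        _ = min 1 ε / 2 := by simp only [δ]; field_simp
        _ < min 1 ε := half_lt_self (by positivity)
    lift t to ℝ≥0 using ht.le
    have htL1 : t * L < 1 := by
      have := htL.trans_le (min_le_left _ _)
      exact_mod_cast this
    have hpos : ∀ x, 0 < (1 + (t : ℝ) • fderiv ℝ H x).det := by
      intro x
      apply hdet
      rw [add_sub_cancel_left, norm_smul, Real.norm_of_nonneg t.coe_nonneg]
      exact (mul_le_mul_of_nonneg_left (norm_fderiv_le_of_lipschitz ℝ hL) t.2).trans_lt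
        (htL.trans_le (min_le_right _ _))
    have hder : ∀ x ∈ U, HasFDerivWithinAt (fun x => x + (t : ℝ) • H x)
        (1 + (t : ℝ) • fderiv ℝ H x) U x := fun x hx =>
      ((hasFDerivAt_id x).add ((hd x hx).hasFDerivAt.const_smul (t : ℝ))).hasFDerivWithinAt
    have hinj := (bijective_add_smul_of_lipschitz hL htL1).injective.injOn (s := U)
    have himg := image_ball_add_smul_of_lipschitz hL h0 htL1
    have hint := integrableOn_image_iff_integrableOn_abs_det_fderiv_smul μ hU.measurableSet
      hder hinj (fun _ => (1 : ℝ))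
    have heq := integral_image_eq_integral_abs_det_fderiv_smul μ hU.measurableSet
      hder hinj (fun _ => (1 : ℝ))
    rw [himg] at hint heq
    simp only [fun x => abs_of_pos (hpos x), smul_eq_mul, mul_one] at hint heq
    refine ⟨hint.1 (integrableOn_const hUfin), heq.symm.trans ?_⟩
    simp
  obtain ⟨s, t, w, ht, hw, hA⟩ := exists_affine_combination_det (E := E) hδ
  rw [show (fun x => (1 + fderiv ℝ H x).det) = _ from funext fun x => hA (fderiv ℝ H x)]
  rw [integral_finsetSum]
  · simp_rw [integral_const_mul]
    rw [Finset.sum_congr rfl fun j _ => by rw [(key (t j) (ht j).1 (ht j).2).2],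
      ← Finset.sum_mul, hw, one_mul]
  · exact fun j _ => ((key (t j) (ht j).1 (ht j).2).1).const_mul _

/-- A segment leaving the ball crosses the sphere, where `h` vanishes; the crossing point is no
farther from the inner endpoint than the outer one is. -/
theorem LipschitzOnWith.lipschitzWith_indicator_ball {E F : Type*} [NormedAddCommGroup E]
    [NormedSpace ℝ E] [NormedAddCommGroup F] {h : E → F} {L : ℝ≥0} {R : ℝ}
    (hL : LipschitzOnWith L h (closedBall 0 R)) (h0 : ∀ x, ‖x‖ = R → h x = 0) :
    LipschitzWith L ((ball 0 R).indicator h) := by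
  have hin : ∀ x, ‖x‖ ≤ R → (ball 0 R).indicator h x = h x := by
    intro x hx
    rcases hx.lt_or_eq with hx | hx
    · exact indicator_of_mem (by simpa using hx) h
    · rw [indicator_of_notMem (by simp [hx]), h0 x hx]
  have hout : ∀ x, R ≤ ‖x‖ → (ball 0 R).indicator h x = 0 := fun x hx =>
    indicator_of_notMem (by simpa using hx) h
  have hcross : ∀ x y, ‖x‖ ≤ R → R ≤ ‖y‖ →
      dist ((ball 0 R).indicator h x) ((ball 0 R).indicator h y) ≤ L * dist x y := by
    intro x y hx hy
    have hcont : ContinuousOn (fun t : ℝ => ‖AffineMap.lineMap x y t‖) (Icc 0 1) :=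
      (AffineMap.lineMap_continuous.norm).continuousOn
    obtain ⟨t, ht, htR⟩ := intermediate_value_Icc zero_le_one hcont
      (show R ∈ Icc _ _ by simpa using ⟨hx, hy⟩)
    rw [hin x hx, hout y hy, ← h0 _ htR]
    refine (hL.dist_le_mul x (by simpa using hx) _ (by simpa using htR.le)).trans ?_
    refine mul_le_mul_of_nonneg_left ?_ L.2
    rw [dist_left_lineMap, Real.norm_of_nonneg ht.1]
    exact mul_le_of_le_one_left dist_nonneg ht.2
  refine LipschitzWith.of_dist_le_mul fun x y => ?_
  rcases le_total ‖x‖ R with hx | hx <;> rcases le_total ‖y‖ R with hy | hy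
  · rw [hin x hx, hin y hy]
    exact hL.dist_le_mul x (by simpa using hx) y (by simpa using hy)
  · exact hcross x y hx hy
  · rw [dist_comm, dist_comm x]
    exact hcross y x hy hx
  · rw [hout x hx, hout y hy, dist_self]
    positivity

variable {E : Type*} [NormedAddCommGroup E] [InnerProductSpace ℝ E] [FiniteDimensional ℝ E]

/-- There is no continuously differentiable retraction of a closed ball onto its sphere. -/
theorem not_exists_contDiff_retraction_sphere {R : ℝ} (hR : 0 < R) {r : E → E}
    (hr : ∀ x ∈ closedBall (0 : E) R, ContDiffAt ℝ 1 r x)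
    (hnorm : ∀ x ∈ closedBall (0 : E) R, ‖r x‖ = R) (hid : ∀ x, ‖x‖ = R → r x = x) : False := by
  borelize E
  let h : E → E := fun x => r x - x
  have hloc : LocallyLipschitzOn (closedBall (0 : E) R) h := by
    intro x hx
    obtain ⟨K, t, ht, hK⟩ := ((hr x hx).sub contDiffAt_id).exists_lipschitzOnWith
    exact ⟨K, t, mem_nhdsWithin_of_mem_nhds ht, hK⟩
  obtain ⟨L, hL⟩ := hloc.exists_lipschitzOnWith_of_compact (isCompact_closedBall 0 R)
  have hLip := hL.lipschitzWith_indicator_ball fun x hx => sub_eq_zero.2 (hid x hx)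
  have heq : ∀ x ∈ ball (0 : E) R, HasFDerivAt ((ball 0 R).indicator h) (fderiv ℝ r x - 1) x := by
    intro x hx
    have h1 : HasFDerivAt h (fderiv ℝ r x - 1) x :=
      (((hr x (ball_subset_closedBall hx)).differentiableAt one_ne_zero).hasFDerivAt).sub
        (hasFDerivAt_id x)
    refine h1.congr_of_eventuallyEq ?_
    filter_upwards [isOpen_ball.mem_nhds hx] with y hy using indicator_of_mem hy h
  have hint := integral_det_one_add_fderiv (volume : Measure E) hLip isOpen_ball
    measure_ball_lt_top.ne (fun x hx => indicator_of_notMem hx h)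
    (fun x hx => (heq x hx).differentiableAt)
  -- Since `‖r‖²` is constant, the range of the derivative is orthogonal to `r x ≠ 0`, so the
  -- derivative is not surjective.
  have hzero : ∀ x ∈ ball (0 : E) R, (1 + fderiv ℝ ((ball 0 R).indicator h) x).det = 0 := by
    intro x hx
    rw [(heq x hx).fderiv, add_sub_cancel]
    by_contra hdet
    have hx' := ball_subset_closedBall hx
    have hd := ((hr x hx').differentiableAt one_ne_zero).hasFDerivAt
    have hsq : HasFDerivAt (fun y => ‖r y‖ ^ 2) (0 : E →L[ℝ] ℝ) x := by
      refine (hasFDerivAt_const (R ^ 2) x).congr_of_eventuallyEq ?_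
      filter_upwards [isOpen_ball.mem_nhds hx] with y hy
      rw [hnorm y (ball_subset_closedBall hy)]
    have hperp := hsq.unique hd.norm_sq
    have hsurj : Function.Surjective (fderiv ℝ r x) := by
      have hu : IsUnit (LinearMap.det (fderiv ℝ r x : E →ₗ[ℝ] E)) := isUnit_iff_ne_zero.2 hdet
      exact (LinearMap.equivOfDetNeZero _ hdet).surjective
    obtain ⟨v, hv⟩ := hsurj (r x)
    have := congrArg (fun l : E →L[ℝ] ℝ => l v) hperp
    simp [hv, hnorm x hx', hR.ne'] at this
  rw [setIntegral_congr_fun measurableSet_ball hzero, integral_zero] at hint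
  exact (ENNReal.toReal_pos (measure_ball_pos volume 0 hR).ne' measure_ball_lt_top.ne).ne hint

/-- **Brouwer fixed point theorem**, for bounded continuous self-maps of a Euclidean space. -/
theorem exists_fixedPoint_of_continuous_of_isBounded_range {F : E → E} (hF : Continuous F)
    (hb : Bornology.IsBounded (range F)) : ∃ x, F x = x := by
  by_contra! hne
  obtain ⟨R, hR, hFR⟩ : ∃ R : ℝ, 0 < R ∧ ∀ x, F x ∈ ball (0 : E) R := by
    obtain ⟨C, hC⟩ := hb.exists_norm_le
    refine ⟨max C 0 + 1, by positivity, fun x => ?_⟩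
    have := hC (F x) (mem_range_self x)
    rw [mem_ball_zero_iff]
    linarith [le_max_left C 0]
  -- A partition of unity glues the local constants `F x` into a `C¹` map `p`. Being closer to `F x`
  -- than `x` is forces `p x ≠ x`.
  obtain ⟨p, hp⟩ := exists_contMDiffMap_forall_mem_convex_of_local_const (n := 1)
    (modelWithCornersSelf ℝ E) (t := fun x => ball (0 : E) R ∩ ball (F x) ‖F x - x‖)
    (fun x => (convex_ball _ _).inter (convex_ball _ _)) (fun x => by
      refine ⟨F x, ?_⟩
      have h1 : ∀ᶠ y in nhds x, dist (F x) (F y) < ‖F y - y‖ := by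
        have hc1 : Continuous fun y => dist (F x) (F y) := by fun_prop
        have hc2 : Continuous fun y => ‖F y - y‖ := by fun_prop
        refine hc1.continuousAt.eventually_lt hc2.continuousAt ?_
        simpa [sub_eq_zero] using hne x
      filter_upwards [h1] with y hy using ⟨hFR x, hy⟩)
  have hpd : ContDiff ℝ 1 p := p.contMDiff.contDiff
  have hpR : ∀ x, ‖p x‖ < R := fun x => by simpa using (hp x).1
  have hu : ∀ x, x - p x ≠ 0 := by
    intro x hx
    have h2 := (hp x).2
    rw [← sub_eq_zero.1 hx, mem_ball, dist_eq_norm, norm_sub_rev] at h2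
    exact lt_irrefl _ h2
  -- `lam x` is the larger root of `a λ² + 2 b λ + ‖x‖² - R² = 0`, so `x + lam x • (x - p x)` is
  -- where the ray from `p x` through `x` meets the sphere. On the sphere `b > 0`, which makes `D`
  -- positive and the root `0`.
  let a : E → ℝ := fun x => ‖x - p x‖ ^ 2
  let b : E → ℝ := fun x => inner ℝ x (x - p x)
  let D : E → ℝ := fun x => b x ^ 2 + a x * (R ^ 2 - ‖x‖ ^ 2)
  let lam : E → ℝ := fun x => (-b x + √(D x)) / a x
  have ha : ∀ x, 0 < a x := fun x => by have := norm_pos_iff.2 (hu x); positivity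
  have hbS : ∀ x, ‖x‖ = R → 0 < b x := by
    intro x hx
    simp only [b]
    rw [inner_sub_right, real_inner_self_eq_norm_sq, hx]
    have h1 := real_inner_le_norm x (p x)
    rw [hx] at h1
    nlinarith [hpR x]
  have hD : ∀ x ∈ closedBall (0 : E) R, 0 < D x := by
    intro x hx
    rw [mem_closedBall_zero_iff] at hx
    rcases hx.lt_or_eq with hx | hx
    · have h1 : ‖x‖ ^ 2 < R ^ 2 := pow_lt_pow_left₀ hx (norm_nonneg x) two_ne_zero
      have := mul_pos (ha x) (sub_pos.2 h1)
      exact add_pos_of_nonneg_of_pos (sq_nonneg _) this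
    · have := hbS x hx
      simp only [D, hx, sub_self, mul_zero, add_zero]
      positivity
  have hac : ContDiff ℝ 1 a := (contDiff_id.sub hpd).norm_sq ℝ
  have hbc : ContDiff ℝ 1 b := contDiff_id.inner ℝ (contDiff_id.sub hpd)
  have hDc : ContDiff ℝ 1 D :=
    (hbc.pow 2).add (hac.mul (contDiff_const.sub (contDiff_id.norm_sq ℝ)))
  refine not_exists_contDiff_retraction_sphere hR (r := fun x => x + lam x • (x - p x)) ?_ ?_ ?_
  · intro x hx
    have hl : ContDiffAt ℝ 1 lam x :=
      (hbc.contDiffAt.neg.add (hDc.contDiffAt.sqrt (hD x hx).ne')).div hac.contDiffAt (ha x).ne'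
    exact contDiffAt_id.add (hl.smul (contDiff_id.sub hpd).contDiffAt)
  · intro x hx
    have hs := Real.sq_sqrt (hD x hx).le
    have hlam : lam x * a x = -b x + √(D x) := div_mul_cancel₀ _ (ha x).ne'
    have key : ‖x + lam x • (x - p x)‖ ^ 2 = R ^ 2 := by
      rw [norm_add_sq_real, inner_smul_right, norm_smul, mul_pow, Real.norm_eq_abs, sq_abs]
      change ‖x‖ ^ 2 + 2 * (lam x * b x) + lam x ^ 2 * a x = R ^ 2
      have hDx : D x = b x ^ 2 + a x * (R ^ 2 - ‖x‖ ^ 2) := rfl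
      have hsq : (lam x * a x + b x) ^ 2 = b x ^ 2 + a x * (R ^ 2 - ‖x‖ ^ 2) := by
        rw [hlam, neg_add_cancel_comm, hs]
      refine mul_left_cancel₀ (ha x).ne' ?_
      linear_combination hsq
    exact (pow_left_inj₀ (norm_nonneg _) hR.le two_ne_zero).1 key
  · intro x hx
    have h0 : lam x = 0 := by
      simp only [lam, D, hx, sub_self, mul_zero, add_zero, Real.sqrt_sq (hbS x hx).le]
      simp
    simp [h0]

end Brouwer

/-! ### Expectations along the play -/

namespace PMF

theorem integral_bind_eq_sum {α β : Type*} [Fintype α] [Finite β] [MeasurableSpace β]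
    [MeasurableSingletonClass β] (p : PMF α) (q : α → PMF β) (f : β → ℝ) :
    ∫ y, f y ∂(p.bind q).toMeasure = ∑ x, (p x).toReal * ∫ y, f y ∂(q x).toMeasure := by
  have := Fintype.ofFinite β
  simp_rw [PMF.integral_eq_sum, PMF.bind_apply, tsum_fintype, smul_eq_mul, Finset.mul_sum]
  rw [Finset.sum_comm]
  refine Finset.sum_congr rfl fun y _ => ?_
  rw [ENNReal.toReal_sum fun x _ => ENNReal.mul_ne_top (p.apply_ne_top x) ((q x).apply_ne_top y),
    Finset.sum_mul]
  refine Finset.sum_congr rfl fun x _ => ?_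
  rw [ENNReal.toReal_mul, mul_assoc]

theorem integral_map_eq_sum {α β : Type*} [Fintype α] [Finite β] [MeasurableSpace β]
    [MeasurableSingletonClass β] (p : PMF α) (g : α → β) (f : β → ℝ) :
    ∫ y, f y ∂(p.map g).toMeasure = ∑ x, (p x).toReal * f (g x) := by
  rw [← PMF.bind_pure_comp, integral_bind_eq_sum]
  simp [PMF.toMeasure_pure, integral_dirac]

end PMF

namespace StochasticGame

theorem toPMF_apply_toReal {B : Type*} [Fintype B] (p : stdSimplex ℝ B) (b : B) :
    (toPMF p b).toReal = p b := by
  rw [toPMF, PMF.ofFintype_apply, ENNReal.toReal_ofReal (show 0 ≤ p b from p.2.1 b)]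

variable {n : ℕ} {S : Type u} [Fintype S] {A : Fin n → Type v} [∀ i, Fintype (A i)]

/-- The mean of `u` over the outcomes at state `s`. -/
noncomputable def outcomeMean (π : Profile n S A) (u : Outcome S A → ℝ) (s : S) : ℝ :=
  ∑ a, jointAction π s a * u ⟨s, a⟩

/-- The mean of a function of the next state, given the last outcome. -/
noncomputable def nextMean (G : StochasticGame n S A) (v : S → ℝ) (x : Outcome S A) : ℝ :=
  ∑ s, G.P x.state x.action s * v s

theorem integral_outcomeAt (π : Profile n S A) (s : S) (u : Outcome S A → ℝ) :
    ∫ x, u x ∂(outcomeAt π s).toMeasure = outcomeMean π u s := by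
  rw [outcomeAt, PMF.integral_map_eq_sum]
  simp_rw [toPMF_apply_toReal]
  rfl

theorem integral_nextOutcome (G : StochasticGame n S A) (π : Profile n S A) (x : Outcome S A)
    (u : Outcome S A → ℝ) :
    ∫ y, u y ∂(G.nextOutcome π x).toMeasure = G.nextMean (outcomeMean π u) x := by
  rw [nextOutcome, PMF.integral_bind_eq_sum]
  simp_rw [toPMF_apply_toReal, integral_outcomeAt]
  rfl

instance (G : StochasticGame n S A) (π : Profile n S A) (s : S) :
    IsProbabilityMeasure (G.playLaw π s) := by
  unfold playLaw; infer_instance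

theorem measurable_comp_eval (u : Outcome S A → ℝ) (t : ℕ) :
    Measurable fun ω : ℕ → Outcome S A => u (ω t) :=
  (measurable_of_countable u).comp (measurable_pi_apply t)

theorem abs_le_sum_abs {X : Type*} [Fintype X] (u : X → ℝ) (x : X) : |u x| ≤ ∑ y, |u y| :=
  Finset.single_le_sum (f := fun y => |u y|) (fun y _ => abs_nonneg (u y)) (Finset.mem_univ x)

theorem integrable_comp_eval (u : Outcome S A → ℝ) (t : ℕ) (μ : Measure (ℕ → Outcome S A))
    [IsFiniteMeasure μ] : Integrable (fun ω => u (ω t)) μ := by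
  have := Fintype.ofFinite (Outcome S A)
  exact Integrable.of_bound (measurable_comp_eval u t).aestronglyMeasurable (∑ y, |u y|)
    (.of_forall fun ω => abs_le_sum_abs u (ω t))

theorem integral_playLaw_zero (G : StochasticGame n S A) (π : Profile n S A) (s : S)
    (u : Outcome S A → ℝ) : ∫ ω, u (ω 0) ∂(G.playLaw π s) = outcomeMean π u s := by
  have hmap : (G.playLaw π s).map (Preorder.frestrictLe 0) =
      (outcomeAt π s).toMeasure.map
        (MeasurableEquiv.piUnique (fun _ : Finset.Iic 0 => Outcome S A)).symm := by
    rw [playLaw, Kernel.trajMeasure, Measure.map_comp _ _ (by fun_prop),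
      Kernel.traj_map_frestrictLe, Kernel.partialTraj_self, Measure.id_comp]
  have hu : Measurable fun h : (∀ _ : Finset.Iic 0, Outcome S A) =>
      u (h ⟨0, Finset.mem_Iic.2 le_rfl⟩) :=
    (measurable_of_countable u).comp (measurable_pi_apply _)
  have h1 := integral_map (μ := G.playLaw π s)
    (Preorder.measurable_frestrictLe (X := fun _ => Outcome S A) 0).aemeasurable
    hu.aestronglyMeasurable
  rw [hmap, integral_map (MeasurableEquiv.measurable _).aemeasurable hu.aestronglyMeasurable] at h1
  rw [← integral_outcomeAt]
  exact h1.symm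

/-- Markov property: the joint law of the history up to `t` and the next outcome is a composition
product with `stepKernel`, which reads only the last outcome. -/
theorem integral_playLaw_succ (G : StochasticGame n S A) (π : Profile n S A) (s : S)
    (u : Outcome S A → ℝ) (t : ℕ) :
    ∫ ω, u (ω (t + 1)) ∂(G.playLaw π s) =
      ∫ ω, G.nextMean (outcomeMean π u) (ω t) ∂(G.playLaw π s) := by
  have hmap := Kernel.map_frestrictLe_trajMeasure_compProd_eq_map_trajMeasure
    (X := fun _ => Outcome S A) (κ := G.stepKernel π) (μ₀ := (outcomeAt π s).toMeasure) (a := t)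
  change (G.playLaw π s).map (Preorder.frestrictLe t) ⊗ₘ _ = (G.playLaw π s).map _ at hmap
  have hu : Measurable fun z : (∀ _ : Finset.Iic t, Outcome S A) × Outcome S A => u z.2 :=
    (measurable_of_countable u).comp measurable_snd
  have hr := (Preorder.measurable_frestrictLe (X := fun _ => Outcome S A) t)
  have : IsProbabilityMeasure ((G.playLaw π s).map (Preorder.frestrictLe t)) :=
    Measure.isProbabilityMeasure_map hr.aemeasurable
  have hint : Integrable (fun z : (∀ _ : Finset.Iic t, Outcome S A) × Outcome S A => u z.2)
      ((G.playLaw π s).map (Preorder.frestrictLe t) ⊗ₘ G.stepKernel π t) := by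
    have := Fintype.ofFinite (Outcome S A)
    exact Integrable.of_bound hu.aestronglyMeasurable (∑ y, |u y|)
      (.of_forall fun z => abs_le_sum_abs u z.2)
  have h1 := Measure.integral_compProd hint
  rw [hmap, integral_map (by fun_prop) hu.aestronglyMeasurable] at h1
  refine h1.trans ?_
  have h2 : ∀ h : (∀ _ : Finset.Iic t, Outcome S A), ∫ y, u y ∂(G.stepKernel π t h) =
      G.nextMean (outcomeMean π u) (h ⟨t, Finset.mem_Iic.2 le_rfl⟩) :=
    fun h => G.integral_nextOutcome π _ u
  simp_rw [h2]
  rw [integral_map hr.aemeasurable]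
  · rfl
  · exact ((measurable_of_countable (G.nextMean (outcomeMean π u))).comp
      (measurable_pi_apply (X := fun _ : Finset.Iic t => Outcome S A)
        ⟨t, Finset.mem_Iic.2 le_rfl⟩)).aestronglyMeasurable

/-! ### Stage rewards and the series for the value -/

/-- The reward of player `i` at an outcome. -/
def outcomeReward (G : StochasticGame n S A) (i : Fin n) (x : Outcome S A) : ℝ :=
  G.r i x.state x.action

/-- The expected reward of player `i` at time `t` when the play starts at `s`. -/
noncomputable def stageReward (G : StochasticGame n S A) (π : Profile n S A) (i : Fin n) :
    ℕ → S → ℝ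
  | 0 => outcomeMean π (G.outcomeReward i)
  | t + 1 => outcomeMean π (G.nextMean (G.stageReward π i t))

theorem integral_outcomeReward (G : StochasticGame n S A) (π : Profile n S A) (i : Fin n) (s : S)
    (t : ℕ) : ∫ ω, G.outcomeReward i (ω t) ∂(G.playLaw π s) = G.stageReward π i t s := by
  -- The claim ranges over all `u` because the Markov step replaces `u` by its conditional mean
  -- before the induction hypothesis is used.
  have key : ∀ (t : ℕ) (u : Outcome S A → ℝ), ∫ ω, u (ω t) ∂(G.playLaw π s) =
      outcomeMean π ((fun w => G.nextMean (outcomeMean π w))^[t] u) s := by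
    intro t
    induction t with
    | zero => exact fun u => G.integral_playLaw_zero π s u
    | succ t ih => exact fun u => by rw [integral_playLaw_succ, ih, Function.iterate_succ_apply]
  rw [key]
  have h : ∀ t, outcomeMean π
      ((fun w => G.nextMean (outcomeMean π w))^[t] (G.outcomeReward i)) =
      G.stageReward π i t := by
    intro t
    induction t with
    | zero => rfl
    | succ t ih => rw [Function.iterate_succ_apply', ih]; rfl
  rw [h]

/-- One bound, uniform in `π`, `t` and `s`, serves both the exchange of sum and integral and the
uniform convergence behind continuity. -/
theorem exists_abs_stageReward_le (G : StochasticGame n S A) (i : Fin n) :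
    ∃ C : ℝ, (∀ x, |G.outcomeReward i x| ≤ C) ∧
      ∀ (π : Profile n S A) (t : ℕ) (s : S), |G.stageReward π i t s| ≤ C := by
  have := Fintype.ofFinite (Outcome S A)
  refine ⟨∑ y, |G.outcomeReward i y|, abs_le_sum_abs _, fun π t s => ?_⟩
  rw [← integral_outcomeReward]
  have h := norm_integral_le_of_norm_le_const (μ := G.playLaw π s)
    (f := fun ω => G.outcomeReward i (ω t)) (.of_forall fun ω => abs_le_sum_abs _ (ω t))
  simpa using h

theorem summable_stageReward (G : StochasticGame n S A) (π : Profile n S A) (i : Fin n) (s : S) :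
    Summable fun t => G.γ ^ t * G.stageReward π i t s := by
  obtain ⟨C, -, hC⟩ := G.exists_abs_stageReward_le i
  refine .of_norm_bounded
    ((summable_geometric_of_lt_one G.γ_nonneg G.γ_lt_one).mul_right C) fun t => ?_
  rw [norm_mul, Real.norm_of_nonneg (pow_nonneg G.γ_nonneg t)]
  exact mul_le_mul_of_nonneg_left (hC π t s) (pow_nonneg G.γ_nonneg t)

theorem value_eq_tsum (G : StochasticGame n S A) (π : Profile n S A) (i : Fin n) (s : S) :
    G.value π i s = ∑' t, G.γ ^ t * G.stageReward π i t s := by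
  obtain ⟨C, hC, -⟩ := G.exists_abs_stageReward_le i
  have hint : ∀ t, Integrable (fun ω : ℕ → Outcome S A => G.γ ^ t * G.outcomeReward i (ω t))
      (G.playLaw π s) := fun t => (integrable_comp_eval _ t _).const_mul _
  have h := integral_tsum_of_summable_integral_norm hint ?_
  · simp_rw [integral_const_mul, integral_outcomeReward] at h
    exact h.symm
  · refine .of_nonneg_of_le (fun t => integral_nonneg fun ω => norm_nonneg _) (fun t => ?_)
      ((summable_geometric_of_lt_one G.γ_nonneg G.γ_lt_one).mul_right C)
    have h1 := integral_mono (hint t).norm (integrable_const (G.γ ^ t * C)) fun ω => by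
      change ‖G.γ ^ t * G.outcomeReward i (ω t)‖ ≤ G.γ ^ t * C
      rw [norm_mul, Real.norm_of_nonneg (pow_nonneg G.γ_nonneg t)]
      exact mul_le_mul_of_nonneg_left (hC _) (pow_nonneg G.γ_nonneg t)
    simpa using h1

/-! ### Bellman equation, continuity of the value, comparison principle -/

/-- The Bellman operator of player `i` under the profile `π`. -/
noncomputable def bellman (G : StochasticGame n S A) (π : Profile n S A) (i : Fin n) (v : S → ℝ)
    (s : S) : ℝ :=
  outcomeMean π (fun x => G.outcomeReward i x + G.γ * G.nextMean v x) s

/-- Splitting off the term `t = 0` leaves `γ` times the mean of the same series at the next state.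
-/
theorem bellman_value (G : StochasticGame n S A) (π : Profile n S A) (i : Fin n) :
    G.bellman π i (G.value π i) = G.value π i := by
  funext s
  have hsum := G.summable_stageReward π i
  have hnext : ∀ x, G.nextMean (G.value π i) x =
      ∑' t, G.γ ^ t * G.nextMean (G.stageReward π i t) x := by
    intro x
    simp_rw [nextMean, value_eq_tsum, Finset.mul_sum, ← tsum_mul_left]
    rw [Summable.tsum_finsetSum fun s' _ => ?_]
    · exact Finset.sum_congr rfl fun s' _ => tsum_congr fun t => by ring
    · exact ((hsum s').mul_left (G.P x.state x.action s')).congr fun t => by ring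
  have hnextsum : ∀ x, Summable fun t => G.γ ^ t * G.nextMean (G.stageReward π i t) x := by
    intro x
    simp_rw [nextMean, Finset.mul_sum]
    exact summable_sum fun s' _ =>
      ((hsum s').mul_left (G.P x.state x.action s')).congr fun t => by ring
  rw [value_eq_tsum, (hsum s).tsum_eq_zero_add]
  simp_rw [bellman, outcomeMean, hnext, mul_add, Finset.sum_add_distrib]
  congr 1
  · simp [stageReward, outcomeMean]
  · simp_rw [stageReward, outcomeMean, Finset.mul_sum, ← tsum_mul_left]
    rw [Summable.tsum_finsetSum fun a _ => ?_]
    · exact Finset.sum_congr rfl fun a _ => tsum_congr fun t => by ring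
    · exact ((hnextsum ⟨s, a⟩).mul_left (G.γ * jointAction π s a)).congr fun t => by ring

theorem continuous_jointAction {n : ℕ} {S : Type u} {A : Fin n → Type v} [∀ i, Fintype (A i)]
    (s : S) (a : ∀ i, A i) :
    Continuous fun π : Profile n S A => jointAction π s a := by
  change Continuous fun π : Profile n S A => ∏ i, (π i s).1 (a i)
  exact continuous_finsetProd _ fun i _ => (continuous_apply (a i)).comp
    (continuous_subtype_val.comp ((continuous_apply s).comp (continuous_apply i)))

theorem continuous_outcomeMean {f : Profile n S A → Outcome S A → ℝ}
    (hf : ∀ x, Continuous fun π => f π x) (s : S) :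
    Continuous fun π => outcomeMean π (f π) s :=
  continuous_finsetSum _ fun a _ => (continuous_jointAction s a).mul (hf _)

theorem continuous_stageReward (G : StochasticGame n S A) (i : Fin n) (t : ℕ) (s : S) :
    Continuous fun π : Profile n S A => G.stageReward π i t s := by
  induction t generalizing s with
  | zero => exact continuous_outcomeMean (f := fun _ => G.outcomeReward i) (fun x => continuous_const) s
  | succ t ih =>
    exact continuous_outcomeMean (f := fun π => G.nextMean (G.stageReward π i t))
      (fun x => continuous_finsetSum _ fun s' _ => continuous_const.mul (ih s')) s

theorem continuous_value (G : StochasticGame n S A) (i : Fin n) (s : S) :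
    Continuous fun π : Profile n S A => G.value π i s := by
  obtain ⟨C, -, hC⟩ := G.exists_abs_stageReward_le i
  simp_rw [value_eq_tsum]
  refine continuous_tsum (fun t => continuous_const.mul (G.continuous_stageReward i t s))
    ((summable_geometric_of_lt_one G.γ_nonneg G.γ_lt_one).mul_right C) fun t π => ?_
  rw [norm_mul, Real.norm_of_nonneg (pow_nonneg G.γ_nonneg t)]
  exact mul_le_mul_of_nonneg_left (hC π t s) (pow_nonneg G.γ_nonneg t)

theorem outcomeMean_mono (π : Profile n S A) (s : S) {u w : Outcome S A → ℝ}
    (h : ∀ a, u ⟨s, a⟩ ≤ w ⟨s, a⟩) : outcomeMean π u s ≤ outcomeMean π w s :=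
  Finset.sum_le_sum fun a _ => mul_le_mul_of_nonneg_left (h a) ((jointAction π s).2.1 a)

theorem nextMean_mono (G : StochasticGame n S A) {v w : S → ℝ} (h : ∀ s, v s ≤ w s)
    (x : Outcome S A) : G.nextMean v x ≤ G.nextMean w x :=
  Finset.sum_le_sum fun s _ => mul_le_mul_of_nonneg_left (h s) ((G.P x.state x.action).2.1 s)

theorem bellman_mono (G : StochasticGame n S A) (π : Profile n S A) (i : Fin n) {v w : S → ℝ}
    (h : ∀ s, v s ≤ w s) (s : S) : G.bellman π i v s ≤ G.bellman π i w s :=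
  outcomeMean_mono π s fun a => by
    have := mul_le_mul_of_nonneg_left (G.nextMean_mono h ⟨s, a⟩) G.γ_nonneg
    linarith

theorem bellman_add_const (G : StochasticGame n S A) (π : Profile n S A) (i : Fin n) (v : S → ℝ)
    (c : ℝ) (s : S) : G.bellman π i (fun s => v s + c) s = G.bellman π i v s + G.γ * c := by
  have hn : ∀ x, G.nextMean (fun s => v s + c) x = G.nextMean v x + c := by
    intro x
    have h1 : ∑ s, G.P x.state x.action s = 1 := (G.P x.state x.action).2.2
    simp_rw [nextMean, mul_add, Finset.sum_add_distrib, ← Finset.sum_mul, h1, one_mul]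
  have h1 : ∑ a, jointAction π s a = 1 := (jointAction π s).2.2
  simp_rw [bellman, outcomeMean, hn, mul_add, ← add_assoc, Finset.sum_add_distrib,
    ← Finset.sum_mul, h1, one_mul]

/-- A subsolution of the Bellman equation lies below every supersolution. -/
theorem le_of_bellman_le (G : StochasticGame n S A) (π : Profile n S A) (i : Fin n) {v w : S → ℝ}
    (hv : ∀ s, v s ≤ G.bellman π i v s) (hw : ∀ s, G.bellman π i w s ≤ w s) (s : S) :
    v s ≤ w s := by
  have : Nonempty S := ⟨s⟩
  obtain ⟨m, hm⟩ := Finite.exists_max fun s => v s - w s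
  -- Applying the operator at the maximizer `m` of `v - w` gives `v m - w m ≤ γ (v m - w m)`.
  have h1 : ∀ s, v s ≤ w s + (v m - w m) := fun s => by linarith [hm s]
  have h2 := G.bellman_mono π i h1 m
  rw [bellman_add_const] at h2
  have h3 : (1 - G.γ) * (v m - w m) ≤ 0 := by linarith [hv m, hw m]
  have h4 : v m - w m ≤ 0 := by
    by_contra! h
    exact h3.not_gt (mul_pos (sub_pos.2 G.γ_lt_one) h)
  linarith [hm s]

theorem value_le_of_bellman_le (G : StochasticGame n S A) (π : Profile n S A) (i : Fin n)
    {w : S → ℝ} (hw : ∀ s, G.bellman π i w s ≤ w s) (s : S) : G.value π i s ≤ w s :=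
  G.le_of_bellman_le π i (fun s => (congrFun (G.bellman_value π i) s).ge) hw s

theorem le_value_of_le_bellman (G : StochasticGame n S A) (π : Profile n S A) (i : Fin n)
    {v : S → ℝ} (hv : ∀ s, v s ≤ G.bellman π i v s) (s : S) : v s ≤ G.value π i s :=
  G.le_of_bellman_le π i hv (fun s => (congrFun (G.bellman_value π i) s).le) s

theorem bellman_congr (G : StochasticGame n S A) {π π' : Profile n S A} {s : S}
    (h : ∀ j, π j s = π' j s) (i : Fin n) (v : S → ℝ) :
    G.bellman π i v s = G.bellman π' i v s := by
  have hj : jointAction π s = jointAction π' s :=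
    Subtype.ext (funext fun a => by simp only [jointAction, h])
  simp only [bellman, outcomeMean, hj]

/-! ### One-shot deviations -/

open Classical in
theorem jointAction_update (π : Profile n S A) (i : Fin n) (σ : Strategy S (A i)) (s : S)
    (a : ∀ j, A j) :
    jointAction (Function.update π i σ) s a =
      σ s (a i) * ∏ j ∈ Finset.univ.erase i, π j s (a j) := by
  change ∏ j, (Function.update π i σ) j s (a j) = _
  rw [← Finset.mul_prod_erase _ _ (Finset.mem_univ i), Function.update_self]
  congr 1
  exact Finset.prod_congr rfl fun j hj => by
    rw [Function.update_of_ne (Finset.ne_of_mem_erase hj)]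

/-- The one-shot value of the pure action `b` at the state `s` with continuation values `v`. -/
noncomputable def actionValue (G : StochasticGame n S A) (π : Profile n S A) (i : Fin n)
    (v : S → ℝ) (s : S) (b : A i) : ℝ :=
  G.bellman (pureDeviation π i s b) i v s

-- The product distribution is linear in the factor of player `i`, so the Bellman operator averages
-- over that player's pure actions.
open Classical in
theorem bellman_update (G : StochasticGame n S A) (π : Profile n S A) (i : Fin n)
    (σ : Strategy S (A i)) (v : S → ℝ) (s : S) :
    G.bellman (Function.update π i σ) i v s = ∑ b, σ s b * G.actionValue π i v s b := by
  simp_rw [actionValue, bellman, outcomeMean, pureDeviation, jointAction_update,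
    Function.update_self, Finset.mul_sum]
  rw [Finset.sum_comm]
  refine Finset.sum_congr rfl fun a _ => ?_
  rw [Finset.sum_eq_single (a i)]
  · change _ = σ s (a i) * ((Pi.single (a i) (1 : ℝ) : A i → ℝ) (a i) * _ * _)
    rw [Pi.single_eq_same, one_mul, mul_assoc]
  · intro b _ hb
    change σ s b * ((Pi.single b (1 : ℝ) : A i → ℝ) (a i) * _ * _) = 0
    rw [Pi.single_eq_of_ne hb.symm, zero_mul, zero_mul, mul_zero]
  · exact fun h => absurd (Finset.mem_univ _) h

theorem value_eq_sum_actionValue (G : StochasticGame n S A) (π : Profile n S A) (i : Fin n)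
    (s : S) : G.value π i s = ∑ b, π i s b * G.actionValue π i (G.value π i) s b := by
  classical
  rw [← bellman_update, Function.update_eq_self, bellman_value]

theorem bellman_pureDeviation_of_ne (G : StochasticGame n S A) (π : Profile n S A) (i : Fin n)
    {s s' : S} (h : s' ≠ s) (b : A i) (v : S → ℝ) :
    G.bellman (pureDeviation π i s b) i v s' = G.bellman π i v s' := by
  refine G.bellman_congr (fun j => ?_) i v
  classical
  unfold pureDeviation
  by_cases hj : j = i
  · subst hj
    rw [Function.update_self, Function.update_of_ne h]
  · rw [Function.update_of_ne hj]

/-- One-shot deviation principle for a single state. -/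
theorem value_lt_value_pureDeviation_iff (G : StochasticGame n S A) (π : Profile n S A)
    (i : Fin n) (s : S) (b : A i) :
    G.value π i s < G.value (pureDeviation π i s b) i s ↔
      G.value π i s < G.actionValue π i (G.value π i) s b := by
  -- Off `s` the old value already solves the deviator's equation; the inequality at `s` alone
  -- decides whether it is a super- or a subsolution.
  have hoff : ∀ s' ≠ s, G.bellman (pureDeviation π i s b) i (G.value π i) s' = G.value π i s' :=
    fun s' h => by rw [bellman_pureDeviation_of_ne G π i h, bellman_value]
  constructor
  · contrapose!
    intro h
    refine G.value_le_of_bellman_le _ i (fun s' => ?_) s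
    by_cases hs : s' = s
    · subst hs; exact h
    · exact (hoff s' hs).le
  · intro h
    have hle := G.le_value_of_le_bellman (pureDeviation π i s b) i (v := G.value π i) fun s' => by
      by_cases hs : s' = s
      · subst hs; exact h.le
      · exact (hoff s' hs).ge
    -- Comparison yields only `≤`; one more Bellman step at `s` retains the strict inequality `h`.
    exact h.trans_le ((G.bellman_mono _ i hle s).trans (congrFun (G.bellman_value _ i) s).le)

/-! ### Equilibria and fixed points as profiles with vanishing gains -/

theorem gain_nonneg (G : StochasticGame n S A) (π : Profile n S A) (i : Fin n) (s : S) (b : A i) :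
    0 ≤ G.gain π i s b :=
  le_max_left _ _

theorem gain_pos_iff (G : StochasticGame n S A) (π : Profile n S A) (i : Fin n) (s : S)
    (b : A i) : 0 < G.gain π i s b ↔ G.value π i s < G.actionValue π i (G.value π i) s b := by
  rw [← value_lt_value_pureDeviation_iff, gain, lt_max_iff, sub_pos]
  simp

theorem isMPE_iff_gain_eq_zero (G : StochasticGame n S A) (π : Profile n S A) :
    G.IsMPE π ↔ ∀ i s b, G.gain π i s b = 0 := by
  classical
  constructor
  · intro h i s b
    refine max_eq_left (sub_nonpos.2 ?_)
    exact h s i _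
  · intro h s i σ
    have hQ : ∀ s b, G.actionValue π i (G.value π i) s b ≤ G.value π i s := fun s b =>
      not_lt.1 fun hlt => ((G.gain_pos_iff π i s b).2 hlt).ne' (h i s b)
    -- With every action value at most the old value, so is any average: the old value is a
    -- supersolution for `σ`.
    convert G.value_le_of_bellman_le (Function.update π i σ) i (w := G.value π i) (fun s => ?_) s
    rw [bellman_update]
    calc ∑ b, σ s b * G.actionValue π i (G.value π i) s b
        ≤ ∑ b, σ s b * G.value π i s :=
          Finset.sum_le_sum fun b _ => mul_le_mul_of_nonneg_left (hQ s b) ((σ s).2.1 b)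
      _ = G.value π i s := by
          have h1 : ∑ b, σ s b = 1 := (σ s).2.2
          rw [← Finset.sum_mul, h1, one_mul]

/-- A fixed point has gains proportional to `π i s`. With positive total, every action in the
support would beat the average of the action values, which is impossible. -/
theorem nashMap_eq_self_iff_gain_eq_zero (G : StochasticGame n S A) (π : Profile n S A) :
    G.nashMap π = π ↔ ∀ i s b, G.gain π i s b = 0 := by
  constructor
  · intro h i s
    have hg := G.gain_nonneg π i s
    have hsum : 0 ≤ ∑ b, G.gain π i s b := Finset.sum_nonneg fun b _ => hg b
    have hfix : ∀ b, G.gain π i s b = π i s b * ∑ c, G.gain π i s c := by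
      intro b
      have hb : (π i s b + G.gain π i s b) / (1 + ∑ c, G.gain π i s c) = π i s b :=
        congrArg (fun ρ : Profile n S A => ρ i s b) h
      rw [div_eq_iff (by linarith)] at hb
      linarith
    suffices h0 : ∑ b, G.gain π i s b = 0 from fun b => by rw [hfix b, h0, mul_zero]
    by_contra hne
    have hpos := lt_of_le_of_ne hsum (Ne.symm hne)
    have h1 : ∑ b, π i s b = 1 := (π i s).2.2
    have hnn : ∀ b, 0 ≤ π i s b := (π i s).2.1
    have hlt : ∀ b, 0 < π i s b → G.value π i s < G.actionValue π i (G.value π i) s b :=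
      fun b hb => (G.gain_pos_iff π i s b).1 (by rw [hfix b]; exact mul_pos hb hpos)
    obtain ⟨b, -, hb⟩ : ∃ b ∈ Finset.univ, 0 < π i s b := by
      by_contra! hall
      linarith [Finset.sum_nonpos hall]
    have hstrict : ∑ c, π i s c * G.value π i s <
        ∑ c, π i s c * G.actionValue π i (G.value π i) s c := by
      refine Finset.sum_lt_sum (fun c _ => ?_)
        ⟨b, Finset.mem_univ b, mul_lt_mul_of_pos_left (hlt b hb) hb⟩
      rcases (hnn c).eq_or_lt with hc | hc
      · rw [← hc, zero_mul, zero_mul]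
      · exact (mul_lt_mul_of_pos_left (hlt c hc) hc).le
    rw [← value_eq_sum_actionValue, ← Finset.sum_mul, h1, one_mul] at hstrict
    exact lt_irrefl _ hstrict
  · intro h
    funext i s
    refine Subtype.ext (funext fun b => ?_)
    change (π i s b + G.gain π i s b) / (1 + ∑ c, G.gain π i s c) = π i s b
    simp [h]

/-! ### Continuity of the Nash map and existence of a fixed point -/

theorem continuous_pureDeviation {n : ℕ} {S : Type u} {A : Fin n → Type v} [∀ i, Fintype (A i)]
    (i : Fin n) (s : S) (b : A i) :
    Continuous fun π : Profile n S A => pureDeviation π i s b := by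
  classical
  unfold pureDeviation
  exact continuous_id.update i ((continuous_apply i).update s continuous_const)

theorem continuous_gain (G : StochasticGame n S A) (i : Fin n) (s : S) (b : A i) :
    Continuous fun π : Profile n S A => G.gain π i s b :=
  continuous_const.max
    (((G.continuous_value i s).comp (continuous_pureDeviation i s b)).sub (G.continuous_value i s))

theorem continuous_nashMap (G : StochasticGame n S A) : Continuous G.nashMap := by
  refine continuous_pi fun i => continuous_pi fun s => Continuous.subtype_mk
    (continuous_pi fun b => ?_) _
  refine Continuous.div ?_ ?_ fun π => ?_
  · have h : Continuous fun π : Profile n S A => π i s b := (continuous_apply b).comp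
      (continuous_subtype_val.comp ((continuous_apply s).comp (continuous_apply i)))
    exact h.add (G.continuous_gain i s b)
  · exact continuous_const.add (continuous_finsetSum _ fun c _ => G.continuous_gain i s c)
  · exact (add_pos_of_pos_of_nonneg one_pos
      (Finset.sum_nonneg fun c _ => G.gain_nonneg π i s c)).ne'

/-- A retraction of `ℝ^B` onto the standard simplex: take positive parts, spread the missing mass
evenly, and normalize. -/
noncomputable def simplexRetraction (B : Type*) [Fintype B] [Nonempty B] (x : B → ℝ) :
    stdSimplex ℝ B :=
  ⟨fun b => (max (x b) 0 + max (1 - ∑ c, max (x c) 0) 0 / Fintype.card B) /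
      max 1 (∑ c, max (x c) 0), by
    have hden : (0 : ℝ) < max 1 (∑ c, max (x c) 0) := lt_max_of_lt_left one_pos
    refine ⟨fun b => by positivity, ?_⟩
    have hcard : (Fintype.card B : ℝ) ≠ 0 := by exact_mod_cast Fintype.card_ne_zero
    rw [← Finset.sum_div, div_eq_one_iff_eq hden.ne', Finset.sum_add_distrib, Finset.sum_const,
      Finset.card_univ, nsmul_eq_mul, mul_div_cancel₀ _ hcard]
    rcases le_total 1 (∑ c, max (x c) 0) with h | h
    · rw [max_eq_right h, max_eq_right (by linarith), add_zero]
    · rw [max_eq_left h, max_eq_left (by linarith)]; ring⟩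

theorem continuous_simplexRetraction (B : Type*) [Fintype B] [Nonempty B] :
    Continuous (simplexRetraction B) := by
  refine Continuous.subtype_mk (continuous_pi fun b => ?_) _
  refine Continuous.div (by fun_prop) (by fun_prop) fun x => ?_
  exact (lt_max_of_lt_left one_pos).ne'

theorem simplexRetraction_coe (B : Type*) [Fintype B] [Nonempty B] (p : stdSimplex ℝ B) :
    simplexRetraction B p.1 = p := by
  have h : ∀ b, max (p.1 b) 0 = p.1 b := fun b => max_eq_left (p.2.1 b)
  refine Subtype.ext (funext fun b => ?_)
  simp [simplexRetraction, h, p.2.2]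

/-- Brouwer's theorem on the product of simplices formed by the strategy profiles. -/
theorem exists_fixedPoint_of_continuous {n : ℕ} {S : Type u} [Fintype S] {A : Fin n → Type v}
    [∀ i, Fintype (A i)] [∀ i, Nonempty (A i)] {f : Profile n S A → Profile n S A}
    (hf : Continuous f) : ∃ π, f π = π := by
  let emb : Profile n S A → EuclideanSpace ℝ (Σ i, S × A i) := fun π => WithLp.toLp 2 fun k => (π k.1 k.2.1).1 k.2.2
  let ret : EuclideanSpace ℝ (Σ i, S × A i) → Profile n S A := fun x i s => simplexRetraction (A i) fun b => x ⟨i, s, b⟩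
  have hemb : Continuous emb :=
    (PiLp.continuous_toLp 2 _).comp (continuous_pi fun k => (continuous_apply k.2.2).comp
      (continuous_subtype_val.comp ((continuous_apply k.2.1).comp (continuous_apply k.1))))
  have hret : Continuous ret := continuous_pi fun i => continuous_pi fun s =>
    (continuous_simplexRetraction (A i)).comp (by fun_prop)
  have hre : ∀ π, ret (emb π) = π := fun π => funext fun i => funext fun s =>
    simplexRetraction_coe (A i) (π i s)
  have hb : Bornology.IsBounded (Set.range (emb ∘ f ∘ ret)) := by
    have : ∀ i, CompactSpace (stdSimplex ℝ (A i)) := fun i =>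
      isCompact_iff_compactSpace.1 (isCompact_stdSimplex ℝ (A i))
    exact (isCompact_range hemb).isBounded.subset (Set.range_comp_subset_range _ _)
  -- As `ret ∘ emb` is the identity, `ret` sends a fixed point of `emb ∘ f ∘ ret` to one of `f`.
  obtain ⟨x, hx⟩ := exists_fixedPoint_of_continuous_of_isBounded_range
    (hemb.comp (hf.comp hret)) hb
  refine ⟨ret x, ?_⟩
  have := congrArg ret hx
  rwa [Function.comp_apply, Function.comp_apply, hre] at this

end StochasticGame

theorem mainTheorem4 {n : ℕ} {S : Type u} [Fintype S] {A : Fin n → Type v}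
    [∀ i, Fintype (A i)] [∀ i, Nonempty (A i)] (G : StochasticGame n S A) :
    (∀ π : StochasticGame.Profile n S A, G.IsMPE π ↔ G.nashMap π = π) ∧
      (∃ π : StochasticGame.Profile n S A, G.nashMap π = π) ∧
      (∃ π : StochasticGame.Profile n S A, G.IsMPE π) := by
  have hiff : ∀ π : StochasticGame.Profile n S A, G.IsMPE π ↔ G.nashMap π = π := fun π =>
    (G.isMPE_iff_gain_eq_zero π).trans (G.nashMap_eq_self_iff_gain_eq_zero π).symm
  obtain ⟨π, hπ⟩ := StochasticGame.exists_fixedPoint_of_continuous G.continuous_nashMap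
  exact ⟨hiff, ⟨π, hπ⟩, π, (hiff π).2 hπ⟩
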